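/- Let $d,q\ge 0$ and $K\ge 2$ be integers. Consider a signal $U_n\in\mathbb R^d$ and observations $Z_n\in\mathbb R^q$, \[ U_n=\Psi(U_{n-1})+\zeta_n,\qquad Z_n=HU_n+\xi_n , \] where $\Psi:\mathbb R^d\to\mathbb R^d$ is measurable, $H\in\mathbb R^{q\times d}$ has rank $q$ (so $q\le d$), the law of $\zeta_n$ given the past depends only on $U_{n-1}$ (measurably), with $\mathbb E(\zeta_n\mid U_{n-1})=0$ and finite conditional covariance $R(U_{n-1})=\mathbb E(\zeta_n\otimes\zeta_n\mid U_{n-1})$, and the $\xi_n$ are i.i.d., independent of the rest, with mean $0$ and covariance $I_q$. The ensemble Kalman filter (EnKF) with $K$ members evolves by \[ \widehat V_n^{(k)}=\Psi(V_{n-1}^{(k)})+\zeta_n^{(k)},\qquad Z_n^{(k)}=Z_n+\xi_n^{(k)},\qquad V_n^{(k)}=\widehat V_n^{(k)}-\widehat C_nH^T(I+H\widehat C_nH^T)^{-1}(H\widehat V_n^{(k)}-Z_n^{(k)}), \] \[ \widehat C_n=\frac1{K-1}\sum_{k=1}^K(\widehat V_n^{(k)}-\overline{\widehat V}_n)\otimes(\widehat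 V_n^{(k)}-\overline{\widehat V}_n),\qquad \overline{\widehat V}_n=\frac1K\sum_{k=1}^K\widehat V_n^{(k)}, \] where, given the past, the noises $\zeta_n,\zeta_n^{(1)},\dots,\zeta_n^{(K)},\xi_n,\xi_n^{(1)},\dots,\xi_n^{(K)}$ are independent, $\zeta_n^{(k)}$ has the law of $\zeta_n$ given $U_{n-1}=V_{n-1}^{(k)}$, and $\xi_n^{(k)}$ has the law of $\xi_n$. The signal-ensemble process $X_n=(U_n,V_n^{(1)},\dots,V_n^{(K)})$ is a Markov chain on $\mathcal X=\mathbb R^d\times\mathbb R^{d\times K}$; let $P$ be its transition kernel and $\mu P^n$ the law of $X_n$ when $X_0\sim\mu$. Assume: 1. (Kinetic energy principle) There are $\beta_h\in(0,1)$ and $K_h>0$ such that $|\Psi(u)|^2+\operatorname{tr}R(u)\le(1-\beta_h)|u|^2+K_h$ for all $u\in\mathbb R^d$. 2. (Nondegenerate system noise) For all $M_1,M_2>0$ there is $\alpha>0$ such that $\mathbb P(\zeta_n\in\cdot\mid U_{n-1}=u)\ge\alpha\lambda_{M_2}(\cdot)$ for all $|u|\le M_1$, where $\lambda_{M_2}$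 is Lebesgue measure restricted to $\{|x|\le M_2\}$. 3. (Strong Lyapunov function) $\mathcal E:\mathcal X\to[0,\infty)$ has compact sublevel sets and, for some $\beta,C>0$, satisfies $\mathbb E(\mathcal E(X_n)\mid X_{n-1}=x)\le(1-\beta)\mathcal E(x)+C$ for all $x\in\mathcal X$. Then the EnKF signal-ensemble process is geometrically ergodic in total variation: $P$ has a unique invariant probability measure $\pi$, and there are $r\in(0,1)$ and $\kappa>0$ such that for every probability measure $\mu$ on $\mathcal X$ and all $n\ge0$ \[ \|\mu P^n-\pi\|_{TV}\le\kappa\,r^n\Big(1+\int\mathcal E\,d\mu\Big). \] In particular, for all probability measures $\mu,\nu$ with $\int\mathcal E\,d\mu<\infty$ and $\int\mathcal E\,d\nu<\infty$ there is a constant $C_{\mu,\nu}$ such that $\|\mu P^n-\nu P^n\|_{TV}\le C_{\mu,\nu}r^n$ for all $n\ge0$. -/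

import Mathlib

open MeasureTheory ProbabilityTheory
open scoped ENNReal Matrix

noncomputable section

namespace EnKF

/-- `ℝᵈ` with the Euclidean norm. -/
abbrev Vec (d : ℕ) : Type := EuclideanSpace ℝ (Fin d)

/-- The matrix `∫ x ⊗ x ν(dx)`, i.e. `𝔼 (ζ ⊗ ζ)` for `ζ` of law `ν`. -/
def secondMoment {d : ℕ} (ν : Measure (Vec d)) : Matrix (Fin d) (Fin d) ℝ :=
  Matrix.of fun i j => ∫ x, x i * x j ∂ν

/-- The matrix `H` acting on Euclidean vectors. -/
def matVec {m n : ℕ} (A : Matrix (Fin m) (Fin n) ℝ) (x : Vec n) : Vec m :=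
  WithLp.toLp 2 (A *ᵥ x.ofLp)

/-- The filtering model: a signal `Uₙ = Ψ(Uₙ₋₁) + ζₙ` in `ℝᵈ` observed through
`Zₙ = H Uₙ + ξₙ` in `ℝ^q`. -/
structure Model (d q : ℕ) where
  /-- The deterministic part of the dynamics. -/
  Psi : Vec d → Vec d
  measurable_Psi : Measurable Psi
  /-- `sysNoise u` is the conditional law of `ζₙ` given `Uₙ₋₁ = u`. -/
  sysNoise : Kernel (Vec d) (Vec d)
  markov_sysNoise : IsMarkovKernel sysNoise
  /-- The system noise has a finite second moment and mean zero. -/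
  memLp_sysNoise : ∀ u, MemLp (fun x : Vec d => x) 2 (sysNoise u)
  mean_sysNoise : ∀ u, ∫ x, x ∂(sysNoise u) = 0
  /-- The observation matrix. -/
  H : Matrix (Fin q) (Fin d) ℝ
  rank_H : H.rank = q
  /-- The common law of the i.i.d. observation noises `ξₙ`. -/
  obsNoise : Measure (Vec q)
  prob_obsNoise : IsProbabilityMeasure obsNoise
  /-- The observation noise has mean zero and identity covariance. -/
  memLp_obsNoise : MemLp (fun x : Vec q => x) 2 obsNoise
  mean_obsNoise : ∫ x, x ∂obsNoise = 0
  cov_obsNoise : secondMoment obsNoise = 1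

attribute [instance] Model.markov_sysNoise Model.prob_obsNoise

variable {d q : ℕ}

/-- The conditional covariance matrix `R(u)` of the (mean zero) system noise. -/
def Model.R (M : Model d q) (u : Vec d) : Matrix (Fin d) (Fin d) ℝ :=
  secondMoment (M.sysNoise u)

/-- Kinetic energy principle. -/
def Model.KineticEnergyPrinciple (M : Model d q) : Prop :=
  ∃ β C : ℝ, 0 < β ∧ β < 1 ∧ 0 < C ∧
    ∀ u : Vec d, ‖M.Psi u‖ ^ 2 + (M.R u).trace ≤ (1 - β) * ‖u‖ ^ 2 + C

/-- Nondegenerate system noise: on bounded sets of states the noise law dominates a positive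
multiple of Lebesgue measure restricted to any prescribed ball. -/
def Model.NondegenerateNoise (M : Model d q) : Prop :=
  ∀ M₁ M₂ : ℝ, 0 < M₁ → 0 < M₂ → ∃ α : ℝ, 0 < α ∧ ∀ u : Vec d, ‖u‖ ≤ M₁ →
    ENNReal.ofReal α • (volume : Measure (Vec d)).restrict (Metric.closedBall 0 M₂)
      ≤ M.sysNoise u

/-- The transition kernel of the signal: the law of `Ψ(u) + ζ` with `ζ` of law `sysNoise u`. -/
def Model.signalKernel (M : Model d q) : Kernel (Vec d) (Vec d) :=
  (Kernel.id ×ₖ M.sysNoise).map fun p => M.Psi p.1 + p.2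

instance (M : Model d q) : IsMarkovKernel M.signalKernel := by
  unfold Model.signalKernel
  exact Kernel.IsMarkovKernel.map _ (by have := M.measurable_Psi; fun_prop)

/-- `K` conditionally independent draws, the `k`-th one from `κ (v k)`. -/
def piKernel {α : Type} [MeasurableSpace α] (κ : Kernel α α) [IsMarkovKernel κ] (K : ℕ) :
    Kernel (Fin K → α) (Fin K → α) where
  toFun v := Measure.pi fun k => κ (v k)
  measurable' := by
    refine Measurable.measure_of_isPiSystem_of_isProbabilityMeasure
      generateFrom_pi.symm isPiSystem_pi ?_
    rintro s ⟨t, ht, rfl⟩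
    simp only [Measure.pi_pi]
    refine Finset.measurable_fun_prod _ fun k _ => ?_
    exact (Kernel.measurable_coe κ (ht k (Set.mem_univ k))).comp (measurable_pi_apply k)

instance {α : Type} [MeasurableSpace α] (κ : Kernel α α) [IsMarkovKernel κ] (K : ℕ) :
    IsMarkovKernel (piKernel κ K) :=
  ⟨fun v => by
    change IsProbabilityMeasure (Measure.pi fun k => κ (v k))
    infer_instance⟩

/-- States `(U, V⁽¹⁾, …, V⁽ᴷ⁾)` of the signal-ensemble process. -/
abbrev State (d K : ℕ) : Type := Vec d × (Fin K → Vec d)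

/-- Signal, forecast ensemble and perturbed observations `(U, V̂⁽¹⁾, …, V̂⁽ᴷ⁾, Z⁽¹⁾, …, Z⁽ᴷ⁾)`. -/
abbrev Forecast (d q K : ℕ) : Type := Vec d × (Fin K → Vec d) × (Fin K → Vec q)

/-- From `((U, V̂), (ξ, ξ⁽¹⁾, …, ξ⁽ᴷ⁾))` form `(U, V̂, Z)` with
`Z⁽ᵏ⁾ = (H U + ξ) + ξ⁽ᵏ⁾`. -/
def Model.observe (M : Model d q) (K : ℕ)
    (w : (Vec d × (Fin K → Vec d)) × (Vec q × (Fin K → Vec q))) : Forecast d q K :=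
  (w.1.1, w.1.2, fun k => (matVec M.H w.1.1 + w.2.1) + w.2.2 k)

/-- Forecast step: given `(u, v)`, the new signal `U ∼ signalKernel u`, the forecasts
`V̂⁽ᵏ⁾ ∼ signalKernel (v k)`, the observation noise `ξ` and the perturbations `ξ⁽ᵏ⁾` are all
independent. -/
def Model.forecastKernel (M : Model d q) (K : ℕ) : Kernel (State d K) (Forecast d q K) :=
  (((M.signalKernel.comap Prod.fst measurable_fst) ×ₖ
      ((piKernel M.signalKernel K).comap Prod.snd measurable_snd)) ×ₖ
    Kernel.const _ (M.obsNoise.prod (Measure.pi fun _ : Fin K => M.obsNoise))).map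
    (M.observe K)

/-- The ensemble mean. -/
def ensembleMean {K : ℕ} (v : Fin K → Vec d) : Vec d := (1 / (K : ℝ)) • ∑ k, v k

/-- The ensemble covariance with normalization `1 / (K - 1)`. -/
def ensembleCov {K : ℕ} (v : Fin K → Vec d) : Matrix (Fin d) (Fin d) ℝ :=
  (1 / ((K : ℝ) - 1)) • ∑ k, Matrix.vecMulVec (v k - ensembleMean v).ofLp
    (v k - ensembleMean v).ofLp

/-- The Kalman gain `C Hᵀ (I + H C Hᵀ)⁻¹`. -/
def gain (H : Matrix (Fin q) (Fin d) ℝ) (C : Matrix (Fin d) (Fin d) ℝ) :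
    Matrix (Fin d) (Fin q) ℝ :=
  C * Hᵀ * (1 + H * C * Hᵀ)⁻¹

/-- Analysis step `V⁽ᵏ⁾ = V̂⁽ᵏ⁾ - Ĉ Hᵀ (I + H Ĉ Hᵀ)⁻¹ (H V̂⁽ᵏ⁾ - Z⁽ᵏ⁾)`. -/
def Model.analysis (M : Model d q) (K : ℕ) (y : Forecast d q K) : State d K :=
  (y.1, fun k => y.2.1 k -
    matVec (gain M.H (ensembleCov y.2.1)) (matVec M.H (y.2.1 k) - y.2.2 k))

/-- The transition kernel of the EnKF signal-ensemble process with `K` ensemble members. -/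
def Model.enkfKernel (M : Model d q) (K : ℕ) : Kernel (State d K) (State d K) :=
  (M.forecastKernel K).map (M.analysis K)

theorem measurable_matVec {α : Type} [MeasurableSpace α] {m n : ℕ}
    {A : α → Matrix (Fin m) (Fin n) ℝ} {x : α → Vec n}
    (hA : ∀ i j, Measurable fun a => A a i j) (hx : Measurable x) :
    Measurable fun a => matVec (A a) (x a) := by
  have hx' : ∀ j, Measurable fun a => (x a).ofLp j := fun j => by fun_prop
  refine (WithLp.measurable_toLp 2 _).comp (measurable_pi_lambda _ fun i => ?_)
  simp only [Matrix.mulVec, dotProduct]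
  exact Finset.measurable_fun_sum _ fun j _ => (hA i j).mul (hx' j)

theorem measurable_mul {α : Type} [MeasurableSpace α] {l m n : ℕ}
    {A : α → Matrix (Fin l) (Fin m) ℝ} {B : α → Matrix (Fin m) (Fin n) ℝ}
    (hA : ∀ i j, Measurable fun a => A a i j) (hB : ∀ i j, Measurable fun a => B a i j) :
    ∀ i j, Measurable fun a => (A a * B a) i j := by
  intro i j
  simp only [Matrix.mul_apply]
  exact Finset.measurable_fun_sum _ fun k _ => (hA i k).mul (hB k j)

theorem measurable_det {α : Type} [MeasurableSpace α] {n : ℕ}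
    {A : α → Matrix (Fin n) (Fin n) ℝ} (hA : ∀ i j, Measurable fun a => A a i j) :
    Measurable fun a => (A a).det := by
  simp only [Matrix.det_apply]
  exact Finset.measurable_fun_sum _ fun σ _ =>
    (Finset.measurable_fun_prod _ fun k _ => hA _ _).const_smul _

theorem measurable_inv {α : Type} [MeasurableSpace α] {n : ℕ}
    {A : α → Matrix (Fin n) (Fin n) ℝ} (hA : ∀ i j, Measurable fun a => A a i j) :
    ∀ i j, Measurable fun a => (A a)⁻¹ i j := by
  intro i j
  simp only [Matrix.inv_def, Ring.inverse_eq_inv, Matrix.smul_apply, smul_eq_mul,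
    Matrix.adjugate_apply]
  refine (measurable_det hA).inv.mul (measurable_det fun k l => ?_)
  by_cases h : k = j
  · subst h; simp
  · simpa [Matrix.updateRow_ne h] using hA k l

theorem Model.measurable_observe (M : Model d q) (K : ℕ) : Measurable (M.observe K) := by
  have h : Measurable fun w : (Vec d × (Fin K → Vec d)) × (Vec q × (Fin K → Vec q)) =>
      matVec M.H w.1.1 := measurable_matVec (fun _ _ => measurable_const) (by fun_prop)
  refine Measurable.prodMk (by fun_prop) (Measurable.prodMk (by fun_prop) ?_)
  refine measurable_pi_lambda _ fun k => ?_
  exact Measurable.add (Measurable.add h (by fun_prop)) (by fun_prop)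

theorem Model.measurable_analysis (M : Model d q) (K : ℕ) : Measurable (M.analysis K) := by
  have hm : Measurable fun y : Forecast d q K => ensembleMean y.2.1 := by
    unfold ensembleMean; fun_prop
  have hC : ∀ i j, Measurable fun y : Forecast d q K => ensembleCov y.2.1 i j := by
    intro i j
    simp only [ensembleCov, Matrix.smul_apply, Matrix.sum_apply, Matrix.vecMulVec_apply,
      smul_eq_mul]
    suffices h : ∀ k, Measurable fun y : Forecast d q K =>
        (y.2.1 k - ensembleMean y.2.1).ofLp i * (y.2.1 k - ensembleMean y.2.1).ofLp j from
      (Finset.measurable_fun_sum _ fun k _ => h k).const_mul _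
    intro k
    have hk : Measurable fun y : Forecast d q K => y.2.1 k - ensembleMean y.2.1 := by fun_prop
    have h' : ∀ i, Measurable fun y : Forecast d q K =>
        (y.2.1 k - ensembleMean y.2.1).ofLp i := fun i => by fun_prop
    exact (h' i).mul (h' j)
  have hc : ∀ {m n : ℕ} (B : Matrix (Fin m) (Fin n) ℝ) (i j),
      Measurable fun _ : Forecast d q K => B i j := fun _ _ _ => measurable_const
  have hG : ∀ i j, Measurable fun y : Forecast d q K => gain M.H (ensembleCov y.2.1) i j := by
    unfold gain
    refine measurable_mul (measurable_mul hC (hc _)) (measurable_inv fun i j => ?_)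
    simp only [Matrix.add_apply]
    have h1 : Measurable fun y : Forecast d q K => (M.H * ensembleCov y.2.1 * M.Hᵀ) i j :=
      measurable_mul (measurable_mul (hc _) hC) (hc _) i j
    exact h1.const_add _
  refine measurable_fst.prodMk (measurable_pi_lambda _ fun k => ?_)
  refine Measurable.sub (by fun_prop) (measurable_matVec hG (Measurable.sub ?_ (by fun_prop)))
  exact measurable_matVec (hc _) (by fun_prop)

instance (M : Model d q) (K : ℕ) : IsMarkovKernel (M.forecastKernel K) :=
  Kernel.IsMarkovKernel.map _ (M.measurable_observe K)

instance (M : Model d q) (K : ℕ) : IsMarkovKernel (M.enkfKernel K) :=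
  Kernel.IsMarkovKernel.map _ (M.measurable_analysis K)

/-- `E` is a strong Lyapunov function for the Markov chain with transition kernel `P`: it is
nonnegative, has compact sublevel sets, and
`𝔼 (E(Xₙ) | Xₙ₋₁ = x) ≤ (1 - β) E(x) + C` for some constants `β, C > 0`. -/
def IsStrongLyapunov {X : Type} [TopologicalSpace X] [MeasurableSpace X]
    (P : Kernel X X) (E : X → ℝ) : Prop :=
  (∀ x, 0 ≤ E x) ∧ (∀ c : ℝ, IsCompact {x | E x ≤ c}) ∧
    ∃ β C : ℝ, 0 < β ∧ 0 < C ∧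
      ∀ x, Integrable E (P x) ∧ ∫ y, E y ∂(P x) ≤ (1 - β) * E x + C

/-- The law of `Xₙ` for the Markov chain with transition kernel `P` and `X₀ ∼ μ`. -/
def lawAt {X : Type} [MeasurableSpace X] (P : Kernel X X) (μ : Measure X) : ℕ → Measure X
  | 0 => μ
  | n + 1 => (lawAt P μ n).bind P

instance {X : Type} [MeasurableSpace X] (P : Kernel X X) [IsMarkovKernel P] (μ : Measure X)
    [IsProbabilityMeasure μ] (n : ℕ) : IsProbabilityMeasure (lawAt P μ n) := by
  induction n with
  | zero => assumption
  | succ n ih => unfold lawAt; infer_instance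

/-- The total variation norm `‖μ - ν‖_TV` of the signed measure `μ - ν`. -/
def tvDist {X : Type} [MeasurableSpace X] (μ ν : Measure X) [IsFiniteMeasure μ]
    [IsFiniteMeasure ν] : ℝ≥0∞ :=
  (μ.toSignedMeasure - ν.toSignedMeasure).totalVariation Set.univ

end EnKF

end

/-!
# Geometric ergodicity of the ensemble Kalman filter

The proof verifies the hypotheses of Harris' theorem: a drift condition, which the strong Lyapunov
function provides, and a minorization of the kernel on every sublevel set of that function.

*Minorization.* Given the state, the signal, the forecast ensemble and the observation noises are
independent, and the new state is the image of these variables under a map (observation followed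
by the Kalman update) that does not depend on the old state. A sublevel set of the Lyapunov
function is compact, so on it the signal and all ensemble members are bounded, and by the kinetic
energy principle so are their images under `Ψ`. Nondegeneracy of the noise on a large enough ball
makes every one-particle law dominate the same multiple of Lebesgue measure on the unit ball
(`EnKF.Model.exists_le_signalKernel`). The product of these measures with the observation noise,
pushed through the update map, is a nonzero measure below the transition kernel at every point of
the sublevel set (`EnKF.Model.exists_le_enkfKernel`). Only measurability of the update is used.

*Harris' theorem* (`EnKF.exists_invariant_tvDist_le`), following Hairer and Mattingly. For a small
weight `b`, one step of the kernel contracts the oscillation of observables measured against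
`2 + b E(x) + b E(y)`: if `E(x) + E(y)` is large the drift condition gains a factor, and otherwise
the common part of the two transition laws cancels (`EnKF.OscBound.transfer_contraction`).
Applied to indicator functions this makes the laws of two chains merge geometrically, uniformly
over measurable sets. Hence the laws along one chain are Cauchy uniformly over measurable sets.
They converge setwise to a probability measure, which is invariant because setwise convergence
carries over to integrals of bounded measurable functions. Since convergence to it holds from each
starting point, dominated convergence gives uniqueness.
-/

namespace EnKF

open Filter Topology Set

/-! ### Total variation and setwise limits -/

section Setwise

variable {X : Type} [MeasurableSpace X]

/-- The total variation norm is twice the supremum over measurable sets, attained on the two parts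
of a Hahn decomposition. -/
theorem tvDist_le_of_forall_abs_sub_le {μ ν : Measure X} [IsFiniteMeasure μ] [IsFiniteMeasure ν]
    {ε : ℝ} (h : ∀ A, MeasurableSet A → |μ.real A - ν.real A| ≤ ε) :
    tvDist μ ν ≤ ENNReal.ofReal (2 * ε) := by
  have hε : 0 ≤ ε := (abs_nonneg _).trans (h ∅ .empty)
  set s := μ.toSignedMeasure - ν.toSignedMeasure with hs
  obtain ⟨i, hi, hpos, hneg, h1, h2⟩ := s.toJordanDecomposition_spec
  have hsA : ∀ A, MeasurableSet A → s A = μ.real A - ν.real A := fun A hA => by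
    simp [hs, Measure.toSignedMeasure_apply, hA]
  have e1 : (s.toMeasureOfZeroLE i hi hpos).real univ = s i := by
    rw [SignedMeasure.toMeasureOfZeroLE_real_apply _ hpos hi .univ, inter_univ]
  have e2 : (s.toMeasureOfLEZero iᶜ hi.compl hneg).real univ = -s iᶜ := by
    rw [SignedMeasure.toMeasureOfLEZero_real_apply _ hneg hi.compl .univ, inter_univ]
  have key : ∀ (m : Measure X) [IsFiniteMeasure m], m.real univ ≤ ε →
      m univ ≤ ENNReal.ofReal ε := fun m _ hm => by
    rw [← ofReal_measureReal]; exact ENNReal.ofReal_le_ofReal hm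
  rw [tvDist, SignedMeasure.totalVariation, ← hs, Measure.add_apply, h1, h2, two_mul,
    ENNReal.ofReal_add hε hε]
  refine add_le_add (key _ ?_) (key _ ?_)
  · rw [e1, hsA i hi]; exact (le_abs_self _).trans (h i hi)
  · rw [e2, hsA _ hi.compl]; exact (neg_le_abs _).trans (h _ hi.compl)

/-- A sequence of probability measures that is Cauchy uniformly over measurable sets converges
setwise to a probability measure. -/
theorem exists_tendsto_measureReal_of_cauchy {p : ℕ → Measure X}
    [∀ n, IsProbabilityMeasure (p n)] {ε : ℕ → ℝ} (hε : Tendsto ε atTop (𝓝 0))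
    (h : ∀ A, MeasurableSet A → ∀ n m, |(p (m + n)).real A - (p n).real A| ≤ ε n) :
    ∃ π : Measure X, IsProbabilityMeasure π ∧
      ∀ A, MeasurableSet A → Tendsto (fun n => (p n).real A) atTop (𝓝 (π.real A)) := by
  have hlim : ∀ A, ∃ l : ℝ, MeasurableSet A →
      Tendsto (fun n => (p n).real A) atTop (𝓝 l) := fun A => by
    by_cases hA : MeasurableSet A
    · have : CauchySeq fun n => (p n).real A := by
        refine cauchySeq_of_le_tendsto_0' ε (fun n m hnm => ?_) hε
        obtain ⟨k, rfl⟩ := Nat.exists_eq_add_of_le' hnm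
        rw [dist_comm, Real.dist_eq]
        exact h A hA n k
      obtain ⟨l, hl⟩ := cauchySeq_tendsto_of_complete this
      exact ⟨l, fun _ => hl⟩
    · exact ⟨0, fun h => absurd h hA⟩
  choose l hl using hlim
  have hl0 : ∀ A, MeasurableSet A → 0 ≤ l A := fun A hA =>
    ge_of_tendsto' (hl A hA) fun n => measureReal_nonneg
  have hdist : ∀ A, MeasurableSet A → ∀ n, l A ≤ (p n).real A + ε n := fun A hA n => by
    refine le_of_tendsto ((tendsto_add_atTop_iff_nat n).2 (hl A hA)) (.of_forall fun m => ?_)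
    have := (abs_le.1 (h A hA n m)).2
    linarith
  have hadd : ∀ A B, MeasurableSet A → MeasurableSet B → Disjoint A B →
      l (A ∪ B) = l A + l B := fun A B hA hB hd => by
    refine tendsto_nhds_unique (hl _ (hA.union hB)) ?_
    exact ((hl A hA).add (hl B hB)).congr fun n => (measureReal_union hd hB).symm
  have hempty : l ∅ = 0 := by
    simpa using hadd ∅ ∅ .empty .empty (by simp)
  have hσ : ∀ f : ℕ → Set X, (∀ i, MeasurableSet (f i)) → Pairwise (Function.onFun Disjoint f) →
      HasSum (fun i => l (f i)) (l (⋃ i, f i)) := fun f hf hd => by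
    have hsplit : ∀ N, l (⋃ i, f i) = ∑ i ∈ Finset.range N, l (f i) + l (⋃ i, f (i + N)) := by
      intro N
      induction N with
      | zero => simp
      | succ N ih =>
        have hU : (⋃ i, f (i + N)) = f N ∪ ⋃ i, f (i + (N + 1)) := by
          rw [← union_iUnion_nat_succ fun i => f (i + N)]
          simp [add_assoc, add_comm 1]
        rw [ih, hU, hadd _ _ (hf N) (.iUnion fun i => hf _), Finset.sum_range_succ]
        · ring
        · exact disjoint_iUnion_right.2 fun i => hd (by omega)
    -- Uniform closeness of `l` to some `p n` lets `l` inherit continuity at `∅` from `p n`.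
    have htail : Tendsto (fun N => l (⋃ i, f (i + N))) atTop (𝓝 0) := by
      refine Metric.tendsto_atTop.2 fun δ hδ => ?_
      obtain ⟨n, hn⟩ := (hε.eventually (gt_mem_nhds (half_pos hδ))).exists
      have hn' : Tendsto (fun N => (p n).real (⋃ i, f (i + N))) atTop (𝓝 0) := by
        have := (ENNReal.tendsto_toReal ENNReal.zero_ne_top).comp
          (tendsto_measure_biUnion_Ici_zero_of_pairwise_disjoint (μ := p n)
            (fun i => (hf i).nullMeasurableSet) hd)
        refine this.congr fun N => ?_
        simp only [Function.comp, Measure.real]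
        congr 2
        ext x
        simp only [mem_iUnion, exists_prop]
        exact ⟨fun ⟨i, hi, hx⟩ => ⟨i - N, by rwa [Nat.sub_add_cancel hi]⟩,
          fun ⟨i, hx⟩ => ⟨i + N, by omega, hx⟩⟩
      obtain ⟨N₀, hN₀⟩ := eventually_atTop.1 (hn'.eventually (gt_mem_nhds (half_pos hδ)))
      refine ⟨N₀, fun N hN => ?_⟩
      have hm : MeasurableSet (⋃ i, f (i + N)) := .iUnion fun i => hf _
      rw [Real.dist_eq, sub_zero, abs_of_nonneg (hl0 _ hm)]
      have := hdist _ hm n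
      have := hN₀ N hN
      linarith
    rw [hasSum_iff_tendsto_nat_of_nonneg fun i => hl0 _ (hf i)]
    have : Tendsto (fun N => l (⋃ i, f i) - l (⋃ i, f (i + N))) atTop (𝓝 (l (⋃ i, f i) - 0)) :=
      tendsto_const_nhds.sub htail
    rw [sub_zero] at this
    refine this.congr fun N => ?_
    rw [hsplit N]; ring
  let π : Measure X := Measure.ofMeasurable (fun A _ => ENNReal.ofReal (l A)) (by simp [hempty])
    fun f hf hd => by
      rw [← (hσ f hf hd).tsum_eq, ENNReal.ofReal_tsum_of_nonneg (fun i => hl0 _ (hf i))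
        (hσ f hf hd).summable]
  have hπ : ∀ A, MeasurableSet A → π A = ENNReal.ofReal (l A) := fun A hA =>
    Measure.ofMeasurable_apply A hA
  refine ⟨π, ⟨?_⟩, fun A hA => ?_⟩
  · have : l univ = 1 := tendsto_nhds_unique (hl univ .univ) (by simp)
    simp [hπ, this]
  · rw [Measure.real, hπ A hA, ENNReal.toReal_ofReal (hl0 A hA)]
    exact hl A hA

theorem integrable_of_mem_Icc {μ : Measure X} [IsFiniteMeasure μ] {φ : X → ℝ}
    (hφ : Measurable φ) (h : ∀ x, φ x ∈ Icc (0 : ℝ) 1) : Integrable φ μ :=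
  .of_bound hφ.aestronglyMeasurable 1
    (.of_forall fun x => by rw [Real.norm_eq_abs, abs_of_nonneg (h x).1]; exact (h x).2)

/-- Setwise convergence of probability measures implies convergence of the integrals of measurable
functions with values in `[0, 1]`, by the layer cake formula. -/
theorem tendsto_integral_of_tendsto_measureReal {p : ℕ → Measure X} {π : Measure X}
    [∀ n, IsProbabilityMeasure (p n)] [IsProbabilityMeasure π]
    (h : ∀ A, MeasurableSet A → Tendsto (fun n => (p n).real A) atTop (𝓝 (π.real A)))
    {f : X → ℝ} (hf : Measurable f) (h01 : ∀ x, f x ∈ Icc (0 : ℝ) 1) :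
    Tendsto (fun n => ∫ x, f x ∂(p n)) atTop (𝓝 (∫ x, f x ∂π)) := by
  have key : ∀ (μ : Measure X) [IsProbabilityMeasure μ],
      ∫ x, f x ∂μ = ∫ t in Ioc (0 : ℝ) 1, μ.real {x | t < f x} := fun μ _ => by
    rw [(integrable_of_mem_Icc hf h01).integral_eq_integral_meas_lt
      (.of_forall fun x => (h01 x).1)]
    refine setIntegral_eq_of_subset_of_forall_sdiff_eq_zero measurableSet_Ioi
      (fun t ht => ht.1) fun t ht => ?_
    have : {x | t < f x} = ∅ := by
      ext x
      simp only [mem_ofPred_eq, mem_empty_iff_false, iff_false, not_lt]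
      by_contra! hx
      exact ht.2 ⟨ht.1, (hx.trans_le (h01 x).2).le⟩
    simp [this]
  simp only [key]
  refine tendsto_integral_of_dominated_convergence (fun _ => 1) (fun n => ?_) (by simp)
    (fun n => .of_forall fun t => ?_)
    (.of_forall fun t => h _ (measurableSet_lt measurable_const hf))
  · have : Antitone fun t => (p n).real {x | t < f x} := fun s t hst =>
      measureReal_mono fun x hx => hst.trans_lt hx
    exact this.measurable.aestronglyMeasurable
  · rw [Real.norm_eq_abs, abs_of_nonneg measureReal_nonneg]
    exact measureReal_le_one

end Setwise

/-! ### Iterates of a Markov kernel -/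

section Iterates

variable {X : Type} [MeasurableSpace X] {P : Kernel X X}

theorem lawAt_add (μ : Measure X) (m n : ℕ) :
    lawAt P μ (m + n) = lawAt P (lawAt P μ m) n := by
  induction n with
  | zero => rfl
  | succ n ih => rw [← add_assoc, lawAt, ih, lawAt]

theorem lawAt_of_invariant {π : Measure X} (h : P.Invariant π) (n : ℕ) : lawAt P π n = π := by
  induction n with
  | zero => rfl
  | succ n ih => rw [lawAt, ih]; exact h

/-- The action `φ ↦ P φ` of a transition kernel on observables. -/
noncomputable def transfer (P : Kernel X X) (φ : X → ℝ) (x : X) : ℝ := ∫ y, φ y ∂(P x)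

theorem measurable_transfer {φ : X → ℝ} (hφ : Measurable φ) : Measurable (transfer P φ) :=
  (hφ.stronglyMeasurable.integral_kernel).measurable

variable [IsMarkovKernel P]

theorem transfer_mem_Icc {φ : X → ℝ} (hφ : Measurable φ) (h : ∀ x, φ x ∈ Icc (0 : ℝ) 1) (x : X) :
    transfer P φ x ∈ Icc (0 : ℝ) 1 := by
  refine ⟨integral_nonneg fun y => (h y).1, ?_⟩
  have hi : Integrable φ (P x) := integrable_of_mem_Icc hφ h
  calc transfer P φ x ≤ ∫ _, (1 : ℝ) ∂(P x) :=
        integral_mono hi (integrable_const (1 : ℝ)) fun y => (h y).2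
    _ = 1 := by simp

theorem integral_bind_eq_integral_transfer {μ : Measure X} [IsProbabilityMeasure μ] {φ : X → ℝ}
    (hφ : Measurable φ) (hi : Integrable φ (μ.bind P)) :
    ∫ x, φ x ∂(μ.bind P) = ∫ x, transfer P φ x ∂μ := by
  rw [← Measure.snd_compProd, Measure.snd] at hi ⊢
  rw [integral_map measurable_snd.aemeasurable hφ.aestronglyMeasurable, Measure.integral_compProd]
  · rfl
  · exact hi.comp_measurable measurable_snd

theorem integral_lawAt {μ : Measure X} [IsProbabilityMeasure μ] (n : ℕ) {φ : X → ℝ}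
    (hφ : Measurable φ) (h : ∀ x, φ x ∈ Icc (0 : ℝ) 1) :
    ∫ x, φ x ∂(lawAt P μ n) = ∫ x, (transfer P)^[n] φ x ∂μ := by
  induction n generalizing φ with
  | zero => rfl
  | succ n ih =>
    rw [lawAt, integral_bind_eq_integral_transfer hφ (integrable_of_mem_Icc hφ h),
      ih (measurable_transfer hφ) (transfer_mem_Icc hφ h), Function.iterate_succ_apply]

end Iterates

/-! ### Harris' theorem -/

section Harris

variable {X : Type} [MeasurableSpace X]

/-- `φ` is measurable and oscillates by at most `s (2 + b E(x) + b E(y))` between `x` and `y`: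
it is `s`-Lipschitz for the weighted discrete metric of Hairer and Mattingly. -/
def OscBound (E : X → ℝ) (b s : ℝ) (φ : X → ℝ) : Prop :=
  Measurable φ ∧ ∀ x y, φ x - φ y ≤ s * (2 + b * E x + b * E y)

variable {E : X → ℝ} {b s : ℝ} {φ : X → ℝ}

/-- After subtraction of a constant, an observable of bounded weighted oscillation is bounded by
the weight. -/
theorem OscBound.exists_centering [Nonempty X] (h : OscBound E b s φ) :
    ∃ c, ∀ x, |φ x + c| ≤ s * (1 + b * E x) := by
  have hb : BddBelow (range fun x => s * (1 + b * E x) - φ x) := by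
    obtain ⟨y⟩ := ‹Nonempty X›
    refine ⟨-(s * (1 + b * E y)) - φ y, ?_⟩
    rintro _ ⟨x, rfl⟩
    have := h.2 x y
    dsimp only
    linarith
  refine ⟨⨅ x, (s * (1 + b * E x) - φ x), fun x => abs_le.2 ⟨?_, ?_⟩⟩
  · have : -(s * (1 + b * E x)) - φ x ≤ ⨅ x, (s * (1 + b * E x) - φ x) :=
      le_ciInf fun y => by have := h.2 y x; linarith
    linarith
  · have := ciInf_le hb x
    linarith

theorem abs_integral_le_of_abs_le {μ : Measure X} [IsProbabilityMeasure μ]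
    (hE : Integrable E μ) (hφ : Measurable φ) (h : ∀ x, |φ x| ≤ s * (1 + b * E x)) :
    Integrable φ μ ∧ |∫ x, φ x ∂μ| ≤ s * (1 + b * ∫ x, E x ∂μ) := by
  have hw : Integrable (fun x => s * (1 + b * E x)) μ :=
    ((integrable_const 1).add (hE.const_mul b)).const_mul s
  refine ⟨hw.mono' hφ.aestronglyMeasurable (.of_forall h), ?_⟩
  have := norm_integral_le_of_norm_le hw (.of_forall h : ∀ᵐ x ∂μ, ‖φ x‖ ≤ s * (1 + b * E x))
  rwa [integral_const_mul, integral_add (integrable_const 1) (hE.const_mul b),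
    integral_const_mul, integral_const, probReal_univ, one_smul] at this

/-- The common part `m` of the measure `μ` does not contribute to the integral. -/
theorem abs_integral_sub_integral_le {μ m : Measure X} [IsProbabilityMeasure μ]
    [IsFiniteMeasure m] (hm : m ≤ μ) (hE0 : ∀ x, 0 ≤ E x) (hb : 0 ≤ b) (hs : 0 ≤ s)
    (hE : Integrable E μ) (hφ : Measurable φ) (h : ∀ x, |φ x| ≤ s * (1 + b * E x)) :
    |∫ x, φ x ∂μ - ∫ x, φ x ∂m| ≤ s * (1 - m.real univ + b * ∫ x, E x ∂μ) := by
  have hφi := (abs_integral_le_of_abs_le hE hφ h).1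
  have hw : Integrable (fun x => s * (1 + b * E x)) μ :=
    ((integrable_const 1).add (hE.const_mul b)).const_mul s
  have hEm := hE.mono_measure hm
  have hwμ : ∫ x, s * (1 + b * E x) ∂μ = s * (1 + b * ∫ x, E x ∂μ) := by
    rw [integral_const_mul, integral_add (integrable_const 1) (hE.const_mul b),
      integral_const_mul, integral_const, probReal_univ, one_smul]
  have hwm : s * m.real univ ≤ ∫ x, s * (1 + b * E x) ∂m := by
    rw [integral_const_mul, integral_add (integrable_const 1) (hEm.const_mul b),
      integral_const_mul, integral_const, smul_eq_mul, mul_one]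
    have : 0 ≤ b * ∫ x, E x ∂m := mul_nonneg hb (integral_nonneg hE0)
    exact mul_le_mul_of_nonneg_left (by linarith) hs
  have h1 : ∫ x, (s * (1 + b * E x) - φ x) ∂m ≤ ∫ x, (s * (1 + b * E x) - φ x) ∂μ :=
    integral_mono_measure hm (.of_forall fun x => sub_nonneg.2 (abs_le.1 (h x)).2) (hw.sub hφi)
  have h2 : ∫ x, (s * (1 + b * E x) + φ x) ∂m ≤ ∫ x, (s * (1 + b * E x) + φ x) ∂μ :=
    integral_mono_measure hm
      (.of_forall fun x => by have := (abs_le.1 (h x)).1; simp only [Pi.zero_apply]; linarith)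
      (hw.add hφi)
  rw [integral_sub (hw.mono_measure hm) (hφi.mono_measure hm), integral_sub hw hφi, hwμ] at h1
  rw [integral_add (hw.mono_measure hm) (hφi.mono_measure hm), integral_add hw hφi, hwμ] at h2
  rw [abs_le]
  constructor <;> linarith

variable {P : Kernel X X} {γ C : ℝ}

theorem OscBound.iterate_transfer {r : ℝ} (hr : 0 ≤ r)
    (hP : ∀ s φ, 0 ≤ s → OscBound E b s φ → OscBound E b (r * s) (transfer P φ)) (hs : 0 ≤ s)
    (h : OscBound E b s φ) (n : ℕ) : OscBound E b (r ^ n * s) ((transfer P)^[n] φ) := by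
  induction n with
  | zero => simpa using h
  | succ n ih =>
    rw [Function.iterate_succ_apply', pow_succ', mul_assoc]
    exact hP _ _ (by positivity) ih

variable [IsMarkovKernel P]

/-- One step of the kernel contracts the weighted oscillation. Where `E x` or `E y` exceeds `R`,
the drift condition gains the factor `r`; elsewhere the common part `m` of `P x` and `P y`
does. -/
theorem OscBound.transfer_contraction [Nonempty X] {m : Measure X} [IsFiniteMeasure m] {R r : ℝ}
    (hE0 : ∀ x, 0 ≤ E x) (hdrift : ∀ x, Integrable E (P x) ∧ ∫ y, E y ∂(P x) ≤ γ * E x + C)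
    (hm : ∀ x, E x ≤ R → m ≤ P x) (hb : 0 ≤ b) (hs : 0 ≤ s)
    (hbC : 2 * b * C ≤ m.real univ) (hγr : γ ≤ r) (hr1 : 1 - m.real univ / 2 ≤ r)
    (hr2 : 2 + 2 * b * C + b * γ * R ≤ r * (2 + b * R)) (h : OscBound E b s φ) :
    OscBound E b (r * s) (transfer P φ) := by
  obtain ⟨c, hc⟩ := h.exists_centering
  have hψ : Measurable fun x => φ x + c := h.1.add_const c
  refine ⟨measurable_transfer h.1, fun x y => ?_⟩
  have hint : ∀ z, ∫ w, (φ w + c) ∂(P z) = transfer P φ z + c := fun z => by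
    have hi := (abs_integral_le_of_abs_le (hdrift z).1 hψ hc).1
    have hφi : Integrable φ (P z) := by
      simpa [Pi.sub_def] using hi.sub (integrable_const c)
    rw [integral_add hφi (integrable_const c)]
    simp [transfer]
  have hD : b * ∫ w, E w ∂(P x) + b * ∫ w, E w ∂(P y) ≤ b * γ * (E x + E y) + 2 * b * C := by
    have hx := mul_le_mul_of_nonneg_left (hdrift x).2 hb
    have hy := mul_le_mul_of_nonneg_left (hdrift y).2 hb
    linarith
  have hS : 0 ≤ E x + E y := add_nonneg (hE0 x) (hE0 y)
  -- Both cases reduce to a bound without the factor `s`.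
  suffices ∃ B, transfer P φ x - transfer P φ y ≤ s * B ∧ B ≤ r * (2 + b * (E x + E y)) by
    obtain ⟨B, hB1, hB2⟩ := this
    have := mul_le_mul_of_nonneg_left hB2 hs
    linarith
  by_cases hR : E x ≤ R ∧ E y ≤ R
  · have hx := abs_integral_sub_integral_le (hm x hR.1) hE0 hb hs (hdrift x).1 hψ hc
    have hy := abs_integral_sub_integral_le (hm y hR.2) hE0 hb hs (hdrift y).1 hψ hc
    rw [hint, abs_le] at hx hy
    refine ⟨2 * (1 - m.real univ) + (b * ∫ w, E w ∂(P x) + b * ∫ w, E w ∂(P y)),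
      by linarith [hx.2, hy.1], ?_⟩
    have := mul_le_mul_of_nonneg_left hγr (mul_nonneg hb hS)
    linarith
  · have hx := (abs_integral_le_of_abs_le (hdrift x).1 hψ hc).2
    have hy := (abs_integral_le_of_abs_le (hdrift y).1 hψ hc).2
    rw [hint, abs_le] at hx hy
    refine ⟨2 + (b * ∫ w, E w ∂(P x) + b * ∫ w, E w ∂(P y)), by linarith [hx.2, hy.1], ?_⟩
    have hRS : R ≤ E x + E y := by
      by_contra! hlt
      exact hR ⟨by linarith [hE0 y], by linarith [hE0 x]⟩
    have := mul_le_mul_of_nonneg_left hRS (mul_nonneg hb (sub_nonneg.2 hγr))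
    linarith

/-- A drift condition and a minorization on sublevel sets yield a weight `b` and a rate `r < 1` for
which the kernel contracts the weighted oscillation. -/
theorem exists_oscBound_contraction [Nonempty X] (hE0 : ∀ x, 0 ≤ E x) (hγ0 : 0 ≤ γ) (hγ1 : γ < 1)
    (hC : 0 < C) (hdrift : ∀ x, Integrable E (P x) ∧ ∫ y, E y ∂(P x) ≤ γ * E x + C)
    (hminor : ∀ R : ℝ, ∃ m : Measure X, IsFiniteMeasure m ∧ m univ ≠ 0 ∧
      ∀ x, E x ≤ R → m ≤ P x) :
    ∃ b r : ℝ, 0 < b ∧ 0 < r ∧ r < 1 ∧ ∀ s φ, 0 ≤ s → OscBound E b s φ →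
      OscBound E b (r * s) (transfer P φ) := by
  have hγ' : 0 < 1 - γ := sub_pos.2 hγ1
  -- Any threshold above `2 C / (1 - γ)` makes the drift condition contracting outside.
  set R := (2 * C + 1) / (1 - γ) with hRdef
  have hR : (1 - γ) * R = 2 * C + 1 := by rw [hRdef]; field_simp
  have hR0 : 0 < R := by positivity
  obtain ⟨m, _, hm0, hm⟩ := hminor R
  have ha : 0 < m.real univ := ENNReal.toReal_pos hm0 (measure_ne_top _ _)
  set a := m.real univ
  -- The weight is small enough that the additive constant of the drift costs at most the mass `a`
  -- gained from the minorizing measure.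
  set b := a / (2 * C) with hbdef
  have hb : 0 < b := by positivity
  have hbC : 2 * b * C = a := by rw [hbdef]; field_simp
  have hden : 0 < 2 + b * R := by positivity
  have hle := le_max_right (1 - a / 2) ((2 + 2 * b * C + b * γ * R) / (2 + b * R))
  refine ⟨b, max (1 - a / 2) ((2 + 2 * b * C + b * γ * R) / (2 + b * R)), hb,
    lt_of_lt_of_le (by positivity) hle, max_lt (by linarith) ?_, fun s φ hs h =>
    h.transfer_contraction hE0 hdrift hm hb.le hs hbC.le ?_ (le_max_left _ _)
      ((div_le_iff₀ hden).1 hle)⟩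
  · rw [div_lt_one hden]
    have : b * ((1 - γ) * R) = b * (2 * C + 1) := by rw [hR]
    linarith
  · refine le_trans ?_ hle
    rw [le_div_iff₀ hden]
    have : 0 < b * C := by positivity
    linarith

theorem oscBound_indicator (hE0 : ∀ x, 0 ≤ E x) (hb : 0 ≤ b) {A : Set X} (hA : MeasurableSet A) :
    OscBound E b (1 / 2) (A.indicator fun _ => 1) := by
  refine ⟨measurable_const.indicator hA, fun x y => ?_⟩
  have h1 : A.indicator (fun _ => (1 : ℝ)) x ≤ 1 := indicator_le_self' (by simp) x
  have h2 : 0 ≤ A.indicator (fun _ => (1 : ℝ)) y := indicator_nonneg (by simp) y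
  have := mul_nonneg hb (hE0 x)
  have := mul_nonneg hb (hE0 y)
  linarith

theorem lawAt_real_eq_integral {μ : Measure X} [IsProbabilityMeasure μ] (n : ℕ) {A : Set X}
    (hA : MeasurableSet A) :
    (lawAt P μ n).real A = ∫ x, (transfer P)^[n] (A.indicator fun _ => 1) x ∂μ := by
  rw [← integral_lawAt n (measurable_const.indicator hA) fun x =>
    ⟨indicator_nonneg (by simp) x, indicator_le_self' (by simp) x⟩, integral_indicator hA]
  simp

/-- Two chains started from laws with finite Lyapunov moments merge geometrically, uniformly over
measurable sets. -/
theorem abs_lawAt_real_sub_le [Nonempty X] {r : ℝ} (hE0 : ∀ x, 0 ≤ E x) (hb : 0 ≤ b) (hr : 0 ≤ r)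
    (hP : ∀ s φ, 0 ≤ s → OscBound E b s φ → OscBound E b (r * s) (transfer P φ))
    {μ ν : Measure X} [IsProbabilityMeasure μ] [IsProbabilityMeasure ν] (hμ : Integrable E μ)
    (hν : Integrable E ν) (n : ℕ) {A : Set X} (hA : MeasurableSet A) :
    |(lawAt P μ n).real A - (lawAt P ν n).real A| ≤
      r ^ n * (1 / 2) * (2 + b * ∫ x, E x ∂μ + b * ∫ x, E x ∂ν) := by
  have h := (oscBound_indicator hE0 hb hA).iterate_transfer hr hP (by norm_num) n
  rw [lawAt_real_eq_integral n hA, lawAt_real_eq_integral n hA]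
  generalize (transfer P)^[n] (A.indicator fun _ => 1) = f at h ⊢
  obtain ⟨c, hc⟩ := h.exists_centering
  have hm : Measurable fun x => f x + c := h.1.add_const c
  have key : ∀ (η : Measure X) [IsProbabilityMeasure η], Integrable E η →
      |∫ x, f x ∂η + c| ≤ r ^ n * (1 / 2) * (1 + b * ∫ x, E x ∂η) := fun η _ hη => by
    obtain ⟨hi, hle⟩ := abs_integral_le_of_abs_le hη hm hc
    have hfi : Integrable f η := by
      simpa [Pi.sub_def] using hi.sub (integrable_const c)
    rw [integral_add hfi (integrable_const c)] at hle
    simpa using hle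
  have h1 := abs_le.1 (key μ hμ)
  have h2 := abs_le.1 (key ν hν)
  rw [abs_le]
  constructor <;> linarith [h1.1, h1.2, h2.1, h2.2]

/-- The drift condition keeps the Lyapunov moments bounded along the chain. -/
theorem integrable_lawAt (hE : Measurable E) (hE0 : ∀ x, 0 ≤ E x) (hγ0 : 0 ≤ γ) (hγ1 : γ < 1)
    (hC : 0 ≤ C) (hdrift : ∀ x, Integrable E (P x) ∧ ∫ y, E y ∂(P x) ≤ γ * E x + C)
    {μ : Measure X} [IsProbabilityMeasure μ] (hμ : Integrable E μ) (n : ℕ) :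
    Integrable E (lawAt P μ n) ∧
      ∫ x, E x ∂(lawAt P μ n) ≤ ∫ x, E x ∂μ + C / (1 - γ) := by
  have hγ' : 0 < 1 - γ := sub_pos.2 hγ1
  have hfix : γ * (C / (1 - γ)) + C = C / (1 - γ) := by field_simp; ring
  induction n with
  | zero => exact ⟨hμ, le_add_of_nonneg_right (by positivity)⟩
  | succ n ih =>
    obtain ⟨ihi, ihle⟩ := ih
    have hd : Integrable (fun x => γ * E x + C) (lawAt P μ n) :=
      (ihi.const_mul γ).add (integrable_const C)
    have ht0 : ∀ x, 0 ≤ transfer P E x := fun x => integral_nonneg hE0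
    have ht : Integrable (transfer P E) (lawAt P μ n) :=
      hd.mono' (measurable_transfer hE).aestronglyMeasurable (.of_forall fun x => by
        rw [Real.norm_eq_abs, abs_of_nonneg (ht0 x)]
        exact (hdrift x).2)
    have hi : Integrable E (lawAt P μ (n + 1)) := by
      refine (Measure.integrable_comp_iff hE.aestronglyMeasurable).2
        ⟨.of_forall fun x => (hdrift x).1, ?_⟩
      simp only [Real.norm_eq_abs, abs_of_nonneg (hE0 _)]
      exact ht
    refine ⟨hi, ?_⟩
    have hle := integral_mono ht hd fun x => (hdrift x).2
    rw [integral_add (ihi.const_mul γ) (integrable_const C), integral_const_mul, integral_const,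
      probReal_univ, one_smul] at hle
    rw [lawAt, integral_bind_eq_integral_transfer hE hi]
    have h1 := mul_le_mul_of_nonneg_left ihle hγ0
    have h2 : γ * ∫ x, E x ∂μ ≤ ∫ x, E x ∂μ :=
      mul_le_of_le_one_left (integral_nonneg hE0) hγ1.le
    linarith

/-- **Harris' theorem**: a drift condition for `E` together with a minorization on each sublevel
set of `E` gives a unique invariant probability measure and geometric convergence to it in total
variation. -/
theorem exists_invariant_tvDist_le [Nonempty X] (hE : Measurable E) (hE0 : ∀ x, 0 ≤ E x)
    (hγ0 : 0 ≤ γ) (hγ1 : γ < 1) (hC : 0 < C)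
    (hdrift : ∀ x, Integrable E (P x) ∧ ∫ y, E y ∂(P x) ≤ γ * E x + C)
    (hminor : ∀ R : ℝ, ∃ m : Measure X, IsFiniteMeasure m ∧ m univ ≠ 0 ∧
      ∀ x, E x ≤ R → m ≤ P x) :
    ∃ (π : Measure X) (_ : IsProbabilityMeasure π) (r κ : ℝ),
      P.Invariant π ∧
      (∀ π' : Measure X, IsProbabilityMeasure π' → P.Invariant π' → π' = π) ∧
      0 < r ∧ r < 1 ∧ 0 < κ ∧
      (∀ (μ : Measure X) [IsProbabilityMeasure μ] (n : ℕ),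
        tvDist (lawAt P μ n) π ≤
          ENNReal.ofReal (κ * r ^ n) * (1 + ∫⁻ x, ENNReal.ofReal (E x) ∂μ)) ∧
      (∀ (μ ν : Measure X) [IsProbabilityMeasure μ] [IsProbabilityMeasure ν],
        Integrable E μ → Integrable E ν → ∃ C : ℝ, 0 < C ∧ ∀ n : ℕ,
          tvDist (lawAt P μ n) (lawAt P ν n) ≤ ENNReal.ofReal (C * r ^ n)) := by
  obtain ⟨b, r, hb, hr0, hr1, hP⟩ :=
    exists_oscBound_contraction hE0 hγ0 hγ1 hC hdrift hminor
  obtain ⟨x₀⟩ := id ‹Nonempty X›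
  have hδ : ∀ x, Integrable E (Measure.dirac x) := fun x =>
    integrable_dirac' hE.stronglyMeasurable (by simp)
  have hδE : ∀ x, ∫ y, E y ∂(Measure.dirac x) = E x := fun x =>
    integral_dirac' _ _ hE.stronglyMeasurable
  have hrn : Tendsto (fun n : ℕ => r ^ n) atTop (𝓝 0) :=
    tendsto_pow_atTop_nhds_zero_of_lt_one hr0.le hr1
  -- `D` bounds the Lyapunov moments along the chain started at `x₀`.
  set D := E x₀ + C / (1 - γ) with hDdef
  have hD0 : 0 ≤ D := add_nonneg (hE0 x₀) (div_nonneg hC.le (sub_pos.2 hγ1).le)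
  set p : ℕ → Measure X := fun n => lawAt P (Measure.dirac x₀) n with hp
  have hmom : ∀ m, Integrable E (p m) ∧ ∫ x, E x ∂(p m) ≤ D := fun m => by
    have := integrable_lawAt hE hE0 hγ0 hγ1 hC.le hdrift (hδ x₀) m
    rwa [hδE] at this
  -- The chain started from `μ` at time `n` against the reference chain at time `m + n`.
  have hcmp : ∀ (μ : Measure X) [IsProbabilityMeasure μ], Integrable E μ →
      ∀ (A : Set X), MeasurableSet A → ∀ n m, |(lawAt P μ n).real A - (p (m + n)).real A| ≤
        r ^ n * (1 / 2) * (2 + b * ∫ x, E x ∂μ + b * D) := fun μ _ hμ A hA n m => by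
    rw [hp]
    dsimp only
    rw [lawAt_add]
    refine (abs_lawAt_real_sub_le hE0 hb.le hr0.le hP hμ (hmom m).1 n hA).trans ?_
    gcongr
    exact (hmom m).2
  obtain ⟨π, hπ, hlim⟩ := exists_tendsto_measureReal_of_cauchy (p := p)
    (ε := fun n => r ^ n * ((1 / 2) * (2 + b * E x₀ + b * D)))
    (by simpa using hrn.mul_const ((1 / 2) * (2 + b * E x₀ + b * D))) fun A hA n m => by
      rw [abs_sub_comm, ← mul_assoc]
      have := hcmp (Measure.dirac x₀) (hδ x₀) A hA n m
      rwa [hδE] at this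
  have hconv : ∀ (μ : Measure X) [IsProbabilityMeasure μ], Integrable E μ →
      ∀ (A : Set X), MeasurableSet A → ∀ n, |(lawAt P μ n).real A - π.real A| ≤
        r ^ n * (1 / 2) * (2 + b * ∫ x, E x ∂μ + b * D) := fun μ _ hμ A hA n => by
    have ht := (tendsto_const_nhds (x := (lawAt P μ n).real A)).sub
      ((tendsto_add_atTop_iff_nat n).2 (hlim A hA))
    exact le_of_tendsto' ht.abs fun m => hcmp μ hμ A hA n m
  have h01 : ∀ (A : Set X) x, A.indicator (fun _ => (1 : ℝ)) x ∈ Icc (0 : ℝ) 1 := fun A x =>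
    ⟨indicator_nonneg (by simp) x, indicator_le_self' (by simp) x⟩
  refine ⟨π, hπ, r, 2 + b * D + b, ?_, fun π' hπ' hinv => ?_, hr0, hr1, by positivity,
    fun μ _ n => ?_, fun μ ν _ _ hμ hν => ?_⟩
  · -- Invariance passes to the setwise limit.
    rw [Kernel.Invariant]
    refine Measure.ext fun A hA => (measureReal_eq_measureReal_iff).1 ?_
    have hmeas : Measurable (A.indicator fun _ => (1 : ℝ)) := measurable_const.indicator hA
    have h1 := tendsto_integral_of_tendsto_measureReal hlim (measurable_transfer (P := P) hmeas)
      (transfer_mem_Icc hmeas (h01 A))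
    have hset : ∀ η : Measure X, IsProbabilityMeasure η →
        ∫ x, transfer P (A.indicator fun _ => 1) x ∂η = (η.bind P).real A := fun η _ => by
      rw [← integral_bind_eq_integral_transfer hmeas (integrable_of_mem_Icc hmeas (h01 A)),
        integral_indicator hA]
      simp
    rw [hset π hπ] at h1
    refine tendsto_nhds_unique (h1.congr fun n => hset (p n) inferInstance) ?_
    exact (tendsto_add_atTop_iff_nat 1).2 (hlim A hA)
  · refine Measure.ext fun A hA => (measureReal_eq_measureReal_iff).1 ?_
    have hmeas : Measurable (A.indicator fun _ => (1 : ℝ)) := measurable_const.indicator hA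
    have hiter : ∀ n, Measurable ((transfer P)^[n] (A.indicator fun _ => 1)) ∧
        ∀ x, (transfer P)^[n] (A.indicator fun _ => 1) x ∈ Icc (0 : ℝ) 1 := fun n => by
      induction n with
      | zero => exact ⟨hmeas, h01 A⟩
      | succ n ih =>
        rw [Function.iterate_succ_apply']
        exact ⟨measurable_transfer ih.1, transfer_mem_Icc ih.1 ih.2⟩
    -- Pointwise convergence of `Pⁿ 1_A` suffices here: `∫ E dπ'` need not be finite a priori.
    have hpt : ∀ x, Tendsto (fun n => (transfer P)^[n] (A.indicator fun _ => 1) x) atTop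
        (𝓝 (π.real A)) := fun x => by
      have hx : ∀ n, (transfer P)^[n] (A.indicator fun _ => 1) x =
          (lawAt P (Measure.dirac x) n).real A := fun n => by
        rw [lawAt_real_eq_integral n hA, integral_dirac' _ _ (hiter n).1.stronglyMeasurable]
      simp only [hx]
      refine tendsto_iff_dist_tendsto_zero.2 (squeeze_zero (fun _ => dist_nonneg)
        (fun n => hconv _ (hδ x) A hA n) ?_)
      simpa [mul_assoc] using hrn.mul_const (1 / 2 * (2 + b * ∫ y, E y ∂(Measure.dirac x) + b * D))
    have hdom := tendsto_integral_of_dominated_convergence (μ := π') (fun _ => (1 : ℝ))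
      (fun n => (hiter n).1.aestronglyMeasurable) (integrable_const _)
      (fun n => .of_forall fun x => by
        rw [Real.norm_eq_abs, abs_of_nonneg ((hiter n).2 x).1]; exact ((hiter n).2 x).2)
      (.of_forall hpt)
    simp only [← lawAt_real_eq_integral _ hA, lawAt_of_invariant hinv, integral_const,
      probReal_univ, one_smul] at hdom
    exact tendsto_nhds_unique tendsto_const_nhds hdom
  · have hκ : 0 < (2 + b * D + b) * r ^ n := by positivity
    by_cases hμ : Integrable E μ
    · refine (tvDist_le_of_forall_abs_sub_le fun A hA => hconv μ hμ A hA n).trans ?_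
      have hI : 0 ≤ ∫ x, E x ∂μ := integral_nonneg hE0
      rw [← ofReal_integral_eq_lintegral_ofReal hμ (.of_forall hE0), ← ENNReal.ofReal_one,
        ← ENNReal.ofReal_add zero_le_one hI, ← ENNReal.ofReal_mul hκ.le]
      refine ENNReal.ofReal_le_ofReal ?_
      have : 2 + b * ∫ x, E x ∂μ + b * D ≤ (2 + b * D + b) * (1 + ∫ x, E x ∂μ) := by
        have h1 : 0 ≤ (2 + b * D) * ∫ x, E x ∂μ := by positivity
        linarith
      have := mul_le_mul_of_nonneg_left this (pow_nonneg hr0.le n)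
      linarith
    · have htop : ∫⁻ x, ENNReal.ofReal (E x) ∂μ = ∞ := by
        by_contra hne
        exact hμ ⟨hE.aestronglyMeasurable,
          (hasFiniteIntegral_iff_ofReal (.of_forall hE0)).2 (lt_top_iff_ne_top.2 hne)⟩
      rw [htop, add_top, ENNReal.mul_top (by simpa using hκ)]
      exact le_top
  · have hI : 0 ≤ ∫ x, E x ∂μ := integral_nonneg hE0
    have hJ : 0 ≤ ∫ x, E x ∂ν := integral_nonneg hE0
    refine ⟨2 + b * ∫ x, E x ∂μ + b * ∫ x, E x ∂ν, by positivity, fun n => ?_⟩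
    refine (tvDist_le_of_forall_abs_sub_le fun A hA =>
      abs_lawAt_real_sub_le hE0 hb.le hr0.le hP hμ hν n hA).trans
      (ENNReal.ofReal_le_ofReal (le_of_eq ?_))
    ring

end Harris

/-! ### Minorization for the ensemble Kalman filter -/

section Minorization

/-- The product of measures is monotone. The proof compares the outer measures that define it on
boxes, where both sides are explicit products. -/
theorem measure_pi_mono {ι : Type*} [Fintype ι] {Y : ι → Type*} [∀ i, MeasurableSpace (Y i)]
    {μ ν : ∀ i, Measure (Y i)} [∀ i, SigmaFinite (μ i)] (h : ∀ i, μ i ≤ ν i) :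
    Measure.pi μ ≤ Measure.pi ν := by
  have hle : (Measure.pi μ).toOuterMeasure ≤
      OuterMeasure.pi fun i => (ν i).toOuterMeasure := by
    refine OuterMeasure.le_pi.2 fun s _ => ?_
    change Measure.pi μ (Set.univ.pi s) ≤ _
    rw [Measure.pi_pi]
    exact Finset.prod_le_prod' fun i _ => h i (s i)
  refine Measure.le_iff.2 fun s hs => ?_
  rw [Measure.pi_def ν, toMeasure_apply _ _ hs]
  exact hle s

variable {d q K : ℕ}

theorem Model.signalKernel_apply (M : Model d q) (u : Vec d) :
    M.signalKernel u = (M.sysNoise u).map fun z => M.Psi u + z := by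
  have hΨ := M.measurable_Psi
  rw [Model.signalKernel, Kernel.map_apply _ (by fun_prop), Kernel.prod_apply, Kernel.id_apply,
    Measure.dirac_prod, Measure.map_map (by fun_prop) (by fun_prop)]
  rfl

theorem Model.trace_R_nonneg (M : Model d q) (u : Vec d) : 0 ≤ (M.R u).trace := by
  refine Finset.sum_nonneg fun i _ => ?_
  simp only [Model.R, secondMoment, Matrix.diag_apply, Matrix.of_apply]
  exact integral_nonneg fun x => mul_self_nonneg _

theorem Model.KineticEnergyPrinciple.exists_norm_Psi_le {M : Model d q}
    (h : M.KineticEnergyPrinciple) (M₁ : ℝ) :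
    ∃ r : ℝ, 0 ≤ r ∧ ∀ u, ‖u‖ ≤ M₁ → ‖M.Psi u‖ ≤ r := by
  obtain ⟨β, C, hβ, -, -, h⟩ := h
  refine ⟨√(M₁ ^ 2 + C), Real.sqrt_nonneg _, fun u hu => Real.le_sqrt_of_sq_le ?_⟩
  have h1 := h u
  have h2 := M.trace_R_nonneg u
  have h3 : ‖u‖ ^ 2 ≤ M₁ ^ 2 := pow_le_pow_left₀ (norm_nonneg u) hu 2
  have h4 : 0 ≤ β * ‖u‖ ^ 2 := by positivity
  linarith

/-- On bounded sets the signal kernel dominates a multiple of Lebesgue measure on the unit ball: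
the noise is nondegenerate on a ball large enough to compensate the bounded shift `Ψ(u)`. -/
theorem Model.exists_le_signalKernel (M : Model d q) (hkin : M.KineticEnergyPrinciple)
    (hnoise : M.NondegenerateNoise) {M₁ : ℝ} (hM₁ : 0 < M₁) :
    ∃ α : ℝ, 0 < α ∧ ∀ u : Vec d, ‖u‖ ≤ M₁ →
      ENNReal.ofReal α • (volume : Measure (Vec d)).restrict (Metric.closedBall 0 1)
        ≤ M.signalKernel u := by
  obtain ⟨r, hr0, hr⟩ := hkin.exists_norm_Psi_le M₁
  obtain ⟨α, hα, h⟩ := hnoise M₁ (r + 1) hM₁ (by linarith)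
  refine ⟨α, hα, fun u hu => ?_⟩
  rw [M.signalKernel_apply]
  have hm : Measurable fun z => M.Psi u + z := measurable_const_add _
  refine le_trans ?_ (Measure.map_mono (h u hu) hm)
  rw [Measure.map_smul]
  gcongr
  refine Measure.le_iff.2 fun A hA => ?_
  rw [Measure.map_apply hm hA, Measure.restrict_apply hA, Measure.restrict_apply (hm hA),
    ← measure_preimage_add volume (M.Psi u)]
  refine measure_mono fun z hz => ⟨hz.1, ?_⟩
  have hz2 : ‖M.Psi u + z‖ ≤ 1 := mem_closedBall_zero_iff.1 hz.2
  have := norm_sub_le (M.Psi u + z) (M.Psi u)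
  rw [add_sub_cancel_left] at this
  exact mem_closedBall_zero_iff.2 (by linarith [hr u hu])

/-- The signal and the forecast ensemble have a law that dominates one fixed measure, uniformly
over bounded sets of initial states. One step of the chain is the image of this law and of the
observation noises under a map that does not depend on the initial state, so the image of the
fixed measure minorizes the transition kernel. -/
theorem Model.exists_le_enkfKernel (M : Model d q) (hkin : M.KineticEnergyPrinciple)
    (hnoise : M.NondegenerateNoise) {M₁ : ℝ} (hM₁ : 0 < M₁) :
    ∃ m : Measure (State d K), IsFiniteMeasure m ∧ m Set.univ ≠ 0 ∧
      ∀ x, ‖x‖ ≤ M₁ → m ≤ M.enkfKernel K x := by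
  obtain ⟨α, hα, h⟩ := M.exists_le_signalKernel hkin hnoise hM₁
  set ρ : Measure (Vec d) :=
    ENNReal.ofReal α • (volume : Measure (Vec d)).restrict (Metric.closedBall 0 1)
  have : IsFiniteMeasure ((volume : Measure (Vec d)).restrict (Metric.closedBall 0 1)) :=
    ⟨by simpa using measure_closedBall_lt_top⟩
  have : IsFiniteMeasure ρ := Measure.smul_finite _ ENNReal.ofReal_ne_top
  have hρ : ρ Set.univ ≠ 0 := by
    have := (Metric.measure_closedBall_pos (volume : Measure (Vec d)) 0 one_pos).ne'
    simpa [ρ] using ⟨hα, this⟩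
  refine ⟨(((ρ.prod (Measure.pi fun _ : Fin K => ρ)).prod
    (M.obsNoise.prod (Measure.pi fun _ : Fin K => M.obsNoise))).map (M.observe K)).map
      (M.analysis K), inferInstance, ?_, fun x hx => ?_⟩
  · rw [Measure.map_apply (M.measurable_analysis K) .univ, Set.preimage_univ,
      Measure.map_apply (M.measurable_observe K) .univ, Set.preimage_univ, ← Set.univ_prod_univ,
      Measure.prod_prod, ← Set.univ_prod_univ, Measure.prod_prod,
      measure_univ (μ := M.obsNoise.prod _), mul_one, Measure.pi_univ]
    exact mul_ne_zero hρ (Finset.prod_ne_zero_iff.2 fun _ _ => hρ)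
  · rw [Model.enkfKernel, Kernel.map_apply _ (M.measurable_analysis K), Model.forecastKernel,
      Kernel.map_apply _ (M.measurable_observe K), Kernel.prod_apply, Kernel.prod_apply,
      Kernel.comap_apply, Kernel.comap_apply, Kernel.const_apply]
    refine Measure.map_mono (Measure.map_mono (Measure.prod_mono (Measure.prod_mono ?_ ?_) le_rfl)
      (M.measurable_observe K)) (M.measurable_analysis K)
    · exact h _ ((norm_fst_le x).trans hx)
    · exact measure_pi_mono fun k => h _ ((norm_le_pi_norm x.2 k).trans ((norm_snd_le x).trans hx))

end Minorization

end EnKF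

theorem mainTheorem5 {d q K : ℕ} (hK : 2 ≤ K) (M : EnKF.Model d q)
    (hkin : M.KineticEnergyPrinciple) (hnoise : M.NondegenerateNoise)
    (E : EnKF.State d K → ℝ) (hE : EnKF.IsStrongLyapunov (M.enkfKernel K) E) :
    ∃ (π : Measure (EnKF.State d K)) (_ : IsProbabilityMeasure π) (r κ : ℝ),
      (M.enkfKernel K).Invariant π ∧
      (∀ π' : Measure (EnKF.State d K), IsProbabilityMeasure π' →
        (M.enkfKernel K).Invariant π' → π' = π) ∧
      0 < r ∧ r < 1 ∧ 0 < κ ∧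
      (∀ (μ : Measure (EnKF.State d K)) [IsProbabilityMeasure μ] (n : ℕ),
        EnKF.tvDist (EnKF.lawAt (M.enkfKernel K) μ n) π ≤
          ENNReal.ofReal (κ * r ^ n) * (1 + ∫⁻ x, ENNReal.ofReal (E x) ∂μ)) ∧
      (∀ (μ ν : Measure (EnKF.State d K)) [IsProbabilityMeasure μ] [IsProbabilityMeasure ν],
        Integrable E μ → Integrable E ν → ∃ C : ℝ, 0 < C ∧ ∀ n : ℕ,
          EnKF.tvDist (EnKF.lawAt (M.enkfKernel K) μ n) (EnKF.lawAt (M.enkfKernel K) ν n) ≤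
            ENNReal.ofReal (C * r ^ n)) := by
  obtain ⟨hE0, hcpt, β, C, hβ, hC, hdrift⟩ := hE
  have hmeas : Measurable E := measurable_of_Iic fun c => (hcpt c).measurableSet
  -- The drift rate may exceed `1`; as `E ≥ 0` it can be lowered to at most `1 / 2`.
  refine EnKF.exists_invariant_tvDist_le (γ := 1 - min β (1 / 2)) hmeas hE0
    (by linarith [min_le_right β (1 / 2)]) (by linarith [lt_min hβ one_half_pos]) hC
    (fun x => ⟨(hdrift x).1, (hdrift x).2.trans ?_⟩) fun R => ?_
  · have := mul_le_mul_of_nonneg_right (min_le_left β (1 / 2)) (hE0 x)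
    linarith
  · obtain ⟨b, hb, hR⟩ := (hcpt R).isBounded.exists_pos_norm_le
    obtain ⟨m, hfin, hpos, hle⟩ := M.exists_le_enkfKernel (K := K) hkin hnoise hb
    exact ⟨m, hfin, hpos, fun x hx => hle x (hR x hx)⟩
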